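/- For $\alpha>0$, $\sigma>0$ and $\mu\in\mathbb R$, let $GGD(\mu,\sigma,\alpha)$ be the distribution on $\mathbb R$ with density $$x\mapsto\frac{\alpha\Lambda}{2\Gamma(1/\alpha)}\exp\left(-\Lambda^{\alpha}|x-\mu|^{\alpha}\right),\qquad \Lambda=\frac1\sigma\sqrt{\frac{\Gamma(3/\alpha)}{\Gamma(1/\alpha)}}.$$ Let $X\sim GGD(\mu_1,\sigma_1,\alpha)$ and $Y\sim GGD(\mu_2,\sigma_2,\beta)$ be independent, where $\alpha,\beta,\sigma_1,\sigma_2>0$ and $\mu_1,\mu_2\in\mathbb R$, and put $\mu=\mu_1+\mu_2$. Then $Z=X+Y$ has a continuous probability density function $f_Z$ on $\mathbb R$, and for every real $z\neq\mu$ $$f_Z(z)=\frac{\sqrt{\pi}}{\Gamma(1/\alpha)\Gamma(1/\beta)|z-\mu|}\;\mathrm H^{0,1;1,1;1,1}_{2,0;1,2;1,2}\left[\frac{\sigma_1^2\Gamma(1/\alpha)}{\Gamma(3/\alpha)(z-\mu)^2},\frac{\sigma_2^2\Gamma(1/\beta)}{\Gamma(3/\beta)(z-\mu)^2}\;\middle|\;{(\frac12,1,1),(0,1,1)\atop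 -}\;\middle|\;{(1-\frac1\alpha,\frac2\alpha)\atop(0,1),(\frac12,1)}\;\middle|\;{(1-\frac1\beta,\frac2\beta)\atop(0,1),(\frac12,1)}\right].$$ Here $\mathrm H$ is the bivariate Fox H-function: for $x,y>0$, the value $\mathrm H^{0,1;1,1;1,1}_{2,0;1,2;1,2}[x,y\,|\cdots]$ with these parameters is the absolutely convergent double Mellin--Barnes integral $$\frac{1}{(2\pi i)^2}\int_{\mathrm{Re}\,\xi=s}\int_{\mathrm{Re}\,\eta=t}\frac{\Gamma(\frac12+\xi+\eta)}{\Gamma(-\xi-\eta)}\cdot\frac{\Gamma(-\xi)\,\Gamma(\frac1\alpha+\frac2\alpha\xi)}{\Gamma(\frac12+\xi)}\cdot\frac{\Gamma(-\eta)\,\Gamma(\frac1\beta+\frac2\beta\eta)}{\Gamma(\frac12+\eta)}\;x^{\xi}y^{\eta}\,d\eta\,d\xi ,$$ taken along any vertical lines that separate the poles of $\Gamma(-\xi)$ and $\Gamma(-\eta)$ (to the right) from those of the other Gamma factors of the numerator (to the left), that is, with $s,t<0$ and $s+t>-\frac12$; such lines exist, and the integral does not depend on their choice. -/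

import Mathlib

open MeasureTheory ProbabilityTheory

/-- The normalizing coefficient `Λ = (1/σ) √(Γ(3/α) / Γ(1/α))`. -/
noncomputable def ggdScale (σ α : ℝ) : ℝ :=
  1 / σ * Real.sqrt (Real.Gamma (3 / α) / Real.Gamma (1 / α))

/-- The generalized Gaussian density with mean `μ`, variance `σ ^ 2` and shape `α`. -/
noncomputable def ggdPDF (μ σ α x : ℝ) : ℝ :=
  α * ggdScale σ α / (2 * Real.Gamma (1 / α)) *
    Real.exp (-(ggdScale σ α ^ α * |x - μ| ^ α))

/-- The generalized Gaussian distribution `GGD(μ, σ, α)` on the real line. -/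
noncomputable def ggd (μ σ α : ℝ) : Measure ℝ :=
  volume.withDensity fun x => ENNReal.ofReal (ggdPDF μ σ α x)

/-- The data `H^{0,n₁;m₂,n₂;m₃,n₃}_{p₁,q₁;p₂,q₂;p₃,q₃}[ · , · | (a;α,A) ; (b;β,B) | (c,γ) ; (d,δ)
| (e,ε) ; (f,φ)]` of a bivariate Fox H-function. The numbers `p₁, q₁, p₂, q₂, p₃, q₃` are the
lengths of the lists `a, b, c, d, e, f`. An entry `(a, α, A)` of `a` or `b` and an entry `(c, γ)`
of the other lists consists of a complex parameter and of positive real coefficients. -/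
structure BivFoxHData where
  n₁ : ℕ
  m₂ : ℕ
  n₂ : ℕ
  m₃ : ℕ
  n₃ : ℕ
  a : List (ℂ × ℝ × ℝ)
  b : List (ℂ × ℝ × ℝ)
  c : List (ℂ × ℝ)
  d : List (ℂ × ℝ)
  e : List (ℂ × ℝ)
  f : List (ℂ × ℝ)
  n₁_le : n₁ ≤ a.length
  n₂_le : n₂ ≤ c.length
  m₂_le : m₂ ≤ d.length
  n₃_le : n₃ ≤ e.length
  m₃_le : m₃ ≤ f.length
  a_pos : ∀ p ∈ a, 0 < p.2.1 ∧ 0 < p.2.2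
  b_pos : ∀ p ∈ b, 0 < p.2.1 ∧ 0 < p.2.2
  c_pos : ∀ p ∈ c, 0 < p.2
  d_pos : ∀ p ∈ d, 0 < p.2
  e_pos : ∀ p ∈ e, 0 < p.2
  f_pos : ∀ p ∈ f, 0 < p.2

namespace BivFoxHData

/-- The univariate kernel
`∏_{j≤m} Γ(d_j - δ_j ξ) ∏_{j≤n} Γ(1 - c_j + γ_j ξ) /
  (∏_{j>m} Γ(1 - d_j + δ_j ξ) ∏_{j>n} Γ(c_j - γ_j ξ))`.
Mathlib's `Complex.Gamma` is `0` at its poles, so that a reciprocal of it is the entire function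
`1/Γ`. -/
noncomputable def kernelOne (m n : ℕ) (c d : List (ℂ × ℝ)) (ξ : ℂ) : ℂ :=
  (((d.take m).map fun p => Complex.Gamma (p.1 - p.2 * ξ)).prod *
      ((c.take n).map fun p => Complex.Gamma (1 - p.1 + p.2 * ξ)).prod) /
    (((d.drop m).map fun p => Complex.Gamma (1 - p.1 + p.2 * ξ)).prod *
      ((c.drop n).map fun p => Complex.Gamma (p.1 - p.2 * ξ)).prod)

/-- The mixed kernel
`∏_{j≤n₁} Γ(1 - a_j + α_j ξ + A_j η) /
  (∏_{j>n₁} Γ(a_j - α_j ξ - A_j η) ∏_j Γ(1 - b_j + β_j ξ + B_j η))`. -/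
noncomputable def kernelTwo (n : ℕ) (a b : List (ℂ × ℝ × ℝ)) (ξ η : ℂ) : ℂ :=
  ((a.take n).map fun p => Complex.Gamma (1 - p.1 + p.2.1 * ξ + p.2.2 * η)).prod /
    (((a.drop n).map fun p => Complex.Gamma (p.1 - p.2.1 * ξ - p.2.2 * η)).prod *
      (b.map fun p => Complex.Gamma (1 - p.1 + p.2.1 * ξ + p.2.2 * η)).prod)

/-- The integrand of the double Mellin-Barnes integral. -/
noncomputable def integrand (D : BivFoxHData) (x y ξ η : ℂ) : ℂ :=
  kernelTwo D.n₁ D.a D.b ξ η * kernelOne D.m₂ D.n₂ D.c D.d ξ * kernelOne D.m₃ D.n₃ D.e D.f η *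
    x ^ ξ * y ^ η

/-- The vertical lines `Re ξ = s`, `Re η = t` separate the poles: those of every
`Γ(d_j - δ_j ξ)`, `j ≤ m₂`, and `Γ(f_j - φ_j η)`, `j ≤ m₃`, lie to the right, those of the other
Gamma factors of the numerator lie to the left. Since the coefficients are positive, this says that
the arguments of all Gamma factors of the numerator have positive real part on the lines. -/
def Separates (D : BivFoxHData) (s t : ℝ) : Prop :=
  (∀ p ∈ D.a.take D.n₁, 0 < 1 - p.1.re + p.2.1 * s + p.2.2 * t) ∧
  (∀ p ∈ D.c.take D.n₂, 0 < 1 - p.1.re + p.2 * s) ∧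
  (∀ p ∈ D.d.take D.m₂, 0 < p.1.re - p.2 * s) ∧
  (∀ p ∈ D.e.take D.n₃, 0 < 1 - p.1.re + p.2 * t) ∧
  (∀ p ∈ D.f.take D.m₃, 0 < p.1.re - p.2 * t)

/-- The integrand on the lines `ξ = s + i u`, `η = t + i v`, as a function of `(u, v)`. -/
noncomputable def onLines (D : BivFoxHData) (x y : ℂ) (s t : ℝ) (w : ℝ × ℝ) : ℂ :=
  D.integrand x y (s + w.1 * Complex.I) (t + w.2 * Complex.I)

/-- `D.HasValue x y h`: separating vertical lines exist and, for every choice of them, the double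
Mellin-Barnes integral `(2πi)⁻² ∫ ∫ D.integrand x y ξ η dξ dη` over `Re ξ = s`, `Re η = t`
converges absolutely and equals `h`. Here `dξ dη = i² du dv`, so that the factor in front of the
integral over `(u, v)` is `(2π)⁻²`. -/
def HasValue (D : BivFoxHData) (x y h : ℂ) : Prop :=
  (∃ s t : ℝ, D.Separates s t) ∧
  ∀ s t : ℝ, D.Separates s t →
    Integrable (D.onLines x y s t) ∧
    1 / (2 * (Real.pi : ℂ)) ^ 2 * ∫ w : ℝ × ℝ, D.onLines x y s t w = h

/-- The bivariate Fox H-function is well defined at `(x, y)`. -/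
def Converges (D : BivFoxHData) (x y : ℂ) : Prop :=
  ∃ h : ℂ, D.HasValue x y h

open Classical in
/-- The value of the bivariate Fox H-function at `(x, y)` (and `0` where it is not defined). -/
noncomputable def H (D : BivFoxHData) (x y : ℂ) : ℂ :=
  if h : D.Converges x y then h.choose else 0

theorem HasValue.H_eq {D : BivFoxHData} {x y h : ℂ} (hh : D.HasValue x y h) : D.H x y = h := by
  have hc : D.Converges x y := ⟨h, hh⟩
  obtain ⟨s, t, hst⟩ := hh.1
  have h1 := (hc.choose_spec.2 s t hst).2
  have h2 := (hh.2 s t hst).2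
  rw [H, dif_pos hc, ← h1, h2]

end BivFoxHData

/-- The data
`H^{0,1;1,1;1,1}_{2,0;1,2;1,2}[ · , · | (1/2;1,1), (0;1,1) ; – | (1-1/α, 2/α) ; (0,1), (1/2,1)
| (1-1/β, 2/β) ; (0,1), (1/2,1)]`. -/
noncomputable def sumGGDData (α β : ℝ) (hα : 0 < α) (hβ : 0 < β) : BivFoxHData where
  n₁ := 1
  m₂ := 1
  n₂ := 1
  m₃ := 1
  n₃ := 1
  a := [(1 / 2, 1, 1), (0, 1, 1)]
  b := []
  c := [(1 - 1 / (α : ℂ), 2 / α)]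
  d := [(0, 1), (1 / 2, 1)]
  e := [(1 - 1 / (β : ℂ), 2 / β)]
  f := [(0, 1), (1 / 2, 1)]
  n₁_le := by simp
  n₂_le := by simp
  m₂_le := by simp
  n₃_le := by simp
  m₃_le := by simp
  a_pos := by simp
  b_pos := by simp
  c_pos := by simpa using hα
  d_pos := by simp
  e_pos := by simpa using hβ
  f_pos := by simp

/-!
The density of `X + Y` is the convolution `∫ f₁(x) f₂(z - x) dx` of the two generalized Gaussian
densities; it is continuous because `f₁` is integrable and `f₂` is bounded and continuous.

Mellin inversion of the Gamma function writes each centred density as a superposition of powers,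
`exp (-(a|x|)^α) = (πα)⁻¹ ∫ Γ((1 + 2ξ)/α) (a|x|)^(-1-2ξ) du` with `ξ = s + iu` and `s > -1/2`
(`exp_neg_rpow_eq_integral_Gamma`). Inserting both representations into the convolution leaves the
inner integral `∫ |x|^(-1-2ξ) |z-x|^(-1-2η) dx`. It converges absolutely exactly when
`Re ξ < 0`, `Re η < 0` and `Re (ξ + η) > -1/2`, which is the condition that the vertical lines
separate the poles (`sumGGDData_separates_iff`). Splitting the real line at `0` and `1` turns it
into a sum of three Beta integrals (`integral_powKernel`), and the reflection and duplication
formulas collapse this sum into the quotient of Gamma factors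
`√π Γ(-ξ) Γ(-η) Γ(1/2+ξ+η) / (Γ(1/2+ξ) Γ(1/2+η) Γ(-ξ-η))` (`betaIntegral_add_add`), that is, into
the remaining factors of the Mellin-Barnes integrand.

The interchange of integrals needs no asymptotics of quotients of Gamma functions: in absolute
value the joint integrand is a product of a function of `u`, a function of `v` and a function of
`x`, and `Γ` is integrable on vertical lines since
`Γ(w) = Γ(w+2) / (w (w+1))` and `|Γ(w+2)| ≤ Γ(Re w + 2)`. Fubini's theorem then yields both the
absolute convergence of the double Mellin-Barnes integral and its value, for every choice of
separating lines.
-/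

/-! ### The Gamma function on vertical lines and Mellin inversion -/

theorem norm_Gamma_le_Gamma_re {s : ℂ} (hs : 0 < s.re) : ‖Complex.Gamma s‖ ≤ Real.Gamma s.re := by
  rw [Complex.Gamma_eq_integral hs, Real.Gamma_eq_integral hs, Complex.GammaIntegral]
  refine (norm_integral_le_integral_norm _).trans_eq ?_
  refine setIntegral_congr_fun measurableSet_Ioi fun x hx => ?_
  simp only [norm_mul, Complex.norm_cpow_eq_rpow_re_of_pos hx, Complex.sub_re, Complex.one_re,
    Complex.norm_real]
  rw [Real.norm_of_nonneg (Real.exp_pos _).le]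

/-- The recursion `Γ(w) = Γ(w+2) / (w (w+1))` bounds `Γ` on the line `Re w = c` by
`Γ(c+2) / (c² + u²)`. -/
theorem integrable_Gamma_vertical {c : ℝ} (hc : 0 < c) :
    Integrable fun u : ℝ => Complex.Gamma (c + u * Complex.I) := by
  have hre : ∀ u : ℝ, (c + u * Complex.I : ℂ).re = c := fun u => by simp
  have hcont : Continuous fun u : ℝ => Complex.Gamma (c + u * Complex.I) := by
    refine continuous_iff_continuousAt.2 fun u => ?_
    refine ContinuousAt.comp (f := fun u : ℝ => (c + u * Complex.I : ℂ)) (g := Complex.Gamma)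
      (Complex.differentiableAt_Gamma _ fun m hm => ?_).continuousAt (by fun_prop)
    have h := congrArg Complex.re hm
    rw [hre u] at h
    simp only [Complex.neg_re, Complex.natCast_re] at h
    linarith [(Nat.cast_nonneg m : (0 : ℝ) ≤ m)]
  have hdom : Integrable fun u : ℝ => Real.Gamma (c + 2) * (c ^ 2 + u ^ 2)⁻¹ := by
    have h := (integrable_inv_one_add_sq.comp_mul_left' (inv_ne_zero hc.ne')).const_mul
      (Real.Gamma (c + 2) * (c ^ 2)⁻¹)
    refine h.congr (Filter.Eventually.of_forall fun u => ?_)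
    simp only
    rw [mul_assoc, ← mul_inv]
    congr 2
    field_simp
  refine hdom.mono' hcont.aestronglyMeasurable (Filter.Eventually.of_forall fun u => ?_)
  set s : ℂ := c + u * Complex.I with hs
  have hsre : s.re = c := hre u
  have hsim : s.im = u := by simp [hs]
  have hs0 : s ≠ 0 := fun h => by rw [h] at hsre; simp at hsre; linarith
  have hs1 : s + 1 ≠ 0 := fun h => by
    have := congrArg Complex.re h
    simp [hsre] at this; linarith
  have h2 : Complex.Gamma (s + 2) = s * (s + 1) * Complex.Gamma s := by
    rw [show s + 2 = s + 1 + 1 by ring, Complex.Gamma_add_one _ hs1, Complex.Gamma_add_one _ hs0]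
    ring
  have h3 : ‖Complex.Gamma (s + 2)‖ ≤ Real.Gamma (c + 2) := by
    have := norm_Gamma_le_Gamma_re (s := s + 2) (by simp [hsre]; linarith)
    simpa [hsre] using this
  have hn0 : ‖s‖ ^ 2 = c ^ 2 + u ^ 2 := by
    rw [Complex.sq_norm, Complex.normSq_apply, hsre, hsim]; ring
  have hn1 : ‖s‖ ≤ ‖s + 1‖ := by
    rw [← abs_of_nonneg (norm_nonneg s), ← abs_of_nonneg (norm_nonneg (s + 1)), ← sq_le_sq,
      Complex.sq_norm, Complex.sq_norm, Complex.normSq_apply, Complex.normSq_apply]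
    simp only [Complex.add_re, Complex.add_im, Complex.one_re, Complex.one_im, hsre, hsim]
    nlinarith
  rw [h2, norm_mul, norm_mul] at h3
  rw [← div_eq_mul_inv, le_div_iff₀ (by positivity), ← hn0]
  refine le_trans ?_ h3
  rw [mul_comm, sq]
  gcongr

/-- Mellin inversion for `Γ`, the Mellin transform of `x ↦ exp (-x)`. -/
theorem exp_neg_eq_integral_Gamma {c x : ℝ} (hc : 0 < c) (hx : 0 < x) :
    (Real.exp (-x) : ℂ) = 1 / (2 * Real.pi) *
      ∫ u : ℝ, (x : ℂ) ^ (-(c + u * Complex.I)) * Complex.Gamma (c + u * Complex.I) := by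
  have hmellin : ∀ u : ℝ, mellin (fun x : ℝ => (Real.exp (-x) : ℂ)) (c + u * Complex.I) =
      Complex.Gamma (c + u * Complex.I) := fun u => by
    rw [← Complex.GammaIntegral_eq_mellin, Complex.Gamma_eq_integral (by simpa using hc)]
  have h := mellinInv_mellin_eq c (fun x : ℝ => (Real.exp (-x) : ℂ)) hx
    ((Complex.GammaIntegral_convergent (s := c) (by simpa using hc)).congr_fun
      (fun t _ => by simp [mul_comm]) measurableSet_Ioi)
    ((integrable_Gamma_vertical hc).congr (Filter.Eventually.of_forall fun u => (hmellin u).symm))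
    (by fun_prop)
  rw [← h, mellinInv]
  simp only [hmellin, smul_eq_mul, Complex.real_smul]
  push_cast
  rfl

/-- Obtained from `exp_neg_eq_integral_Gamma` by evaluating at `y ^ α` and rescaling the line of
integration; the variable `ξ = s + iu` is chosen such that the power of `y` is `-1-2ξ`. -/
theorem exp_neg_rpow_eq_integral_Gamma {α s y : ℝ} (hα : 0 < α) (hs : -(1 / 2) < s) (hy : 0 < y) :
    (Real.exp (-y ^ α) : ℂ) = 1 / (Real.pi * α) *
      ∫ u : ℝ, Complex.Gamma ((1 + 2 * (s + u * Complex.I)) / α) *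
        (y : ℂ) ^ (-(1 + 2 * (s + u * Complex.I))) := by
  have hα' : (α : ℂ) ≠ 0 := by exact_mod_cast hα.ne'
  have hc : 0 < (1 + 2 * s) / α := div_pos (by linarith) hα
  rw [exp_neg_eq_integral_Gamma hc (Real.rpow_pos_of_pos hy α)]
  have h := Measure.integral_comp_mul_left (fun u : ℝ => ((y ^ α : ℝ) : ℂ) ^
    (-(((1 + 2 * s) / α : ℝ) + u * Complex.I)) *
      Complex.Gamma (((1 + 2 * s) / α : ℝ) + u * Complex.I)) (2 / α)
  rw [abs_of_pos (by positivity), inv_div, Complex.real_smul] at h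
  have hE : ∀ u : ℝ, ((y ^ α : ℝ) : ℂ) ^ (-(((1 + 2 * s) / α : ℝ) + (2 / α * u : ℝ) * Complex.I)) *
      Complex.Gamma (((1 + 2 * s) / α : ℝ) + (2 / α * u : ℝ) * Complex.I) =
      Complex.Gamma ((1 + 2 * (s + u * Complex.I)) / α) *
        (y : ℂ) ^ (-(1 + 2 * (s + u * Complex.I))) := fun u => by
    have h1 : (((1 + 2 * s) / α : ℝ) + (2 / α * u : ℝ) * Complex.I : ℂ) =
        (1 + 2 * (s + u * Complex.I)) / α := by push_cast; field_simp; ring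
    rw [h1, mul_comm, ← Complex.cpow_mul_ofReal_nonneg hy.le]
    congr 2
    field_simp
  simp only [hE] at h
  have hpi : (Real.pi : ℂ) ≠ 0 := by exact_mod_cast Real.pi_ne_zero
  rw [h, ← mul_assoc]
  congr 1
  push_cast
  field_simp

/-! ### The Beta integral over the whole real line -/

/-- The function `|x|^(p-1) |1-x|^(q-1)` on the real line, the integrand of the Beta integral
extended beyond the unit interval. -/
noncomputable def powKernel (p q : ℂ) (x : ℝ) : ℂ :=
  ((|x| : ℝ) : ℂ) ^ (p - 1) * ((|1 - x| : ℝ) : ℂ) ^ (q - 1)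

theorem powKernel_one_sub (p q : ℂ) (x : ℝ) : powKernel p q (1 - x) = powKernel q p x := by
  rw [powKernel, powKernel, mul_comm, sub_sub_cancel]

theorem integral_powKernel_Ioc {p q : ℂ} (hp : 0 < p.re) (hq : 0 < q.re) :
    IntegrableOn (powKernel p q) (Set.Ioc 0 1) ∧
      ∫ x in Set.Ioc 0 1, powKernel p q x = Complex.betaIntegral p q := by
  have hE : Set.EqOn (fun x : ℝ => (x : ℂ) ^ (p - 1) * (1 - (x : ℂ)) ^ (q - 1))
      (powKernel p q) (Set.Ioc 0 1) := fun x hx => by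
    simp only [powKernel]
    rw [abs_of_pos hx.1, abs_of_nonneg (sub_nonneg.2 hx.2)]
    push_cast
    rfl
  refine ⟨((intervalIntegrable_iff_integrableOn_Ioc_of_le zero_le_one).1
    (Complex.betaIntegral_convergent hp hq)).congr_fun hE measurableSet_Ioc, ?_⟩
  rw [Complex.betaIntegral, intervalIntegral.integral_of_le zero_le_one]
  exact (setIntegral_congr_fun measurableSet_Ioc hE).symm

/-- The substitution `x ↦ x⁻¹` maps this integral to one over the unit interval. -/
theorem integral_powKernel_Ioi {p q : ℂ} (hq : 0 < q.re) (hpq : (p + q).re < 1) :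
    IntegrableOn (powKernel p q) (Set.Ioi 1) ∧
      ∫ x in Set.Ioi 1, powKernel p q x = Complex.betaIntegral (1 - p - q) q := by
  have himg : (fun x : ℝ => x⁻¹) '' Set.Ioo 0 1 = Set.Ioi 1 := by
    ext y
    constructor
    · rintro ⟨x, hx, rfl⟩
      exact (one_lt_inv₀ hx.1).2 hx.2
    · intro hy
      have hy0 : 0 < y := zero_lt_one.trans hy
      exact ⟨y⁻¹, ⟨inv_pos.2 hy0, inv_lt_one_of_one_lt₀ hy⟩, inv_inv y⟩
  have hderiv : ∀ x ∈ Set.Ioo (0 : ℝ) 1,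
      HasDerivWithinAt (fun x : ℝ => x⁻¹) (-(x ^ 2)⁻¹) (Set.Ioo 0 1) x := fun x hx =>
    (hasDerivAt_inv hx.1.ne').hasDerivWithinAt
  have hinj : Set.InjOn (fun x : ℝ => x⁻¹) (Set.Ioo 0 1) := inv_injective.injOn
  have hE : Set.EqOn (fun x : ℝ => |-(x ^ 2)⁻¹| • powKernel p q x⁻¹)
      (powKernel (1 - p - q) q) (Set.Ioo 0 1) := fun x hx => by
    have hx0 : (x : ℂ) ≠ 0 := by exact_mod_cast hx.1.ne'
    have h1 : 1 - x⁻¹ = -(x⁻¹ * (1 - x)) := by field_simp [hx.1.ne']; ring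
    simp only [powKernel]
    rw [h1, abs_neg, abs_neg, abs_of_pos (inv_pos.2 (pow_pos hx.1 2)), abs_mul,
      abs_of_pos (inv_pos.2 hx.1), Complex.ofReal_mul,
      Complex.mul_cpow_ofReal_nonneg (inv_pos.2 hx.1).le (abs_nonneg _), Complex.real_smul,
      abs_of_pos hx.1]
    have h2 : ∀ w : ℂ, ((x⁻¹ : ℝ) : ℂ) ^ w = (x : ℂ) ^ (-w) := fun w => by
      rw [Complex.ofReal_inv, Complex.inv_cpow _ _ (by
        rw [Complex.arg_ofReal_of_nonneg hx.1.le]; exact Real.pi_pos.ne), Complex.cpow_neg]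
    have h3 : (((x ^ 2)⁻¹ : ℝ) : ℂ) = (x : ℂ) ^ (-2 : ℂ) := by
      rw [Complex.cpow_neg]; norm_num
    rw [h2, h2, h3, ← mul_assoc, ← mul_assoc, ← Complex.cpow_add _ _ hx0,
      ← Complex.cpow_add _ _ hx0]
    congr 2
    ring
  have hB := integral_powKernel_Ioc (p := 1 - p - q) (by
    simp only [Complex.add_re, Complex.sub_re, Complex.one_re] at hpq ⊢; linarith) hq
  rw [← himg, integrableOn_image_iff_integrableOn_abs_deriv_smul measurableSet_Ioo hderiv hinj,
    integral_image_eq_integral_abs_deriv_smul measurableSet_Ioo hderiv hinj,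
    integrableOn_congr_fun hE measurableSet_Ioo, setIntegral_congr_fun measurableSet_Ioo hE,
    ← integral_Ioc_eq_integral_Ioo]
  exact ⟨hB.1.mono_set Set.Ioo_subset_Ioc_self, hB.2⟩

/-- The reflection `x ↦ 1 - x` exchanges `(-∞, 0)` with `(1, ∞)` and `p` with `q`. -/
theorem integral_powKernel_Iio {p q : ℂ} (hp : 0 < p.re) (hpq : (p + q).re < 1) :
    IntegrableOn (powKernel p q) (Set.Iio 0) ∧
      ∫ x in Set.Iio 0, powKernel p q x = Complex.betaIntegral (1 - p - q) p := by
  have h := integral_powKernel_Ioi hp (by rwa [add_comm] : (q + p).re < 1)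
  have hm := Measure.measurePreserving_sub_left (volume : Measure ℝ) 1
  have he : MeasurableEmbedding fun x : ℝ => 1 - x :=
    (Homeomorph.subLeft (1 : ℝ)).measurableEmbedding
  have hpre : (fun x : ℝ => 1 - x) ⁻¹' Set.Ioi 1 = Set.Iio 0 := by ext x; simp
  have hc : (powKernel q p ∘ fun x : ℝ => 1 - x) = powKernel p q :=
    funext fun x => powKernel_one_sub q p x
  constructor
  · rw [← hpre, ← hc]
    exact (hm.integrableOn_comp_preimage he).2 h.1
  · have h2 := hm.setIntegral_preimage_emb he (powKernel q p) (Set.Ioi 1)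
    rw [hpre] at h2
    simp only [powKernel_one_sub] at h2
    rw [h2, h.2]
    congr 1
    ring

theorem integral_powKernel {p q : ℂ} (hp : 0 < p.re) (hq : 0 < q.re) (hpq : (p + q).re < 1) :
    Integrable (powKernel p q) ∧ ∫ x, powKernel p q x = Complex.betaIntegral p q +
      Complex.betaIntegral (1 - p - q) q + Complex.betaIntegral (1 - p - q) p := by
  have h1 := integral_powKernel_Ioc hp hq
  have h2 := integral_powKernel_Ioi hq hpq
  have h3 := integral_powKernel_Iio hp hpq
  have hIoi : Set.Ioc (0 : ℝ) 1 ∪ Set.Ioi 1 = Set.Ioi 0 := Set.Ioc_union_Ioi_eq_Ioi zero_le_one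
  have h12 : IntegrableOn (powKernel p q) (Set.Ioi 0) := hIoi ▸ h1.1.union h2.1
  have h3' : IntegrableOn (powKernel p q) (Set.Iic 0) :=
    (integrableOn_Iic_iff_integrableOn_Iio).2 h3.1
  have hint : Integrable (powKernel p q) := by
    rw [← integrableOn_univ, ← Set.Iic_union_Ioi (a := (0 : ℝ))]
    exact h3'.union h12
  refine ⟨hint, ?_⟩
  rw [← intervalIntegral.integral_Iic_add_Ioi h3' h12, integral_Iic_eq_integral_Iio, h3.2, ← hIoi,
    setIntegral_union (Set.Ioc_disjoint_Ioi le_rfl) measurableSet_Ioi h1.1 h2.1, h1.2, h2.2]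
  ring

/-- The one-dimensional Riesz composition formula, with the constant as a sum of Beta integrals. -/
theorem integral_abs_cpow_mul_abs_sub_cpow {p q : ℂ} (hp : 0 < p.re) (hq : 0 < q.re)
    (hpq : (p + q).re < 1) {z : ℝ} (hz : z ≠ 0) :
    Integrable (fun x : ℝ => ((|x| : ℝ) : ℂ) ^ (p - 1) * ((|z - x| : ℝ) : ℂ) ^ (q - 1)) ∧
    ∫ x : ℝ, ((|x| : ℝ) : ℂ) ^ (p - 1) * ((|z - x| : ℝ) : ℂ) ^ (q - 1) =
      ((|z| : ℝ) : ℂ) ^ (p + q - 1) * (Complex.betaIntegral p q +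
      Complex.betaIntegral (1 - p - q) q + Complex.betaIntegral (1 - p - q) p) := by
  have hz' : ((|z| : ℝ) : ℂ) ≠ 0 := by exact_mod_cast abs_ne_zero.2 hz
  set g : ℝ → ℂ := fun x => ((|x| : ℝ) : ℂ) ^ (p - 1) * ((|z - x| : ℝ) : ℂ) ^ (q - 1) with hg
  have hs : (fun x : ℝ => g (z * x)) =
      fun x => ((|z| : ℝ) : ℂ) ^ (p + q - 2) * powKernel p q x := funext fun x => by
    simp only [hg, powKernel]
    rw [show z - z * x = z * (1 - x) by ring, abs_mul, abs_mul, Complex.ofReal_mul,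
      Complex.ofReal_mul, Complex.mul_cpow_ofReal_nonneg (abs_nonneg _) (abs_nonneg _),
      Complex.mul_cpow_ofReal_nonneg (abs_nonneg _) (abs_nonneg _),
      show p + q - 2 = (p - 1) + (q - 1) by ring, Complex.cpow_add _ _ hz']
    ring
  have hk := integral_powKernel hp hq hpq
  constructor
  · rw [← integrable_comp_mul_left_iff g hz, hs]
    exact hk.1.const_mul _
  · have h := Measure.integral_comp_mul_left g z
    rw [hs, integral_const_mul, hk.2, abs_inv, Complex.real_smul, Complex.ofReal_inv] at h
    rw [← mul_right_inj' (inv_ne_zero hz'), ← h, ← mul_assoc]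
    congr 1
    rw [show p + q - 1 = (p + q - 2) + 1 by ring, Complex.cpow_add _ _ hz', Complex.cpow_one]
    field_simp

/-! ### A trigonometric form of the sum of three Beta functions -/

/-- The duplication formula at `z/2` combined with the reflection formula at `(1-z)/2`, written
without a division by `Γ((1-z)/2)`. -/
theorem Gamma_mul_cos_half (z : ℂ) (h : Complex.cos (Real.pi * z / 2) ≠ 0) :
    Complex.Gamma z * Complex.cos (Real.pi * z / 2) * Complex.Gamma ((1 - z) / 2) =
      2 ^ (z - 1) * (Real.sqrt Real.pi : ℂ) * Complex.Gamma (z / 2) := by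
  have hpi : (Real.pi : ℂ) ≠ 0 := by exact_mod_cast Real.pi_ne_zero
  have hdup := Complex.Gamma_mul_Gamma_add_half (z / 2)
  have hrefl := Complex.Gamma_mul_Gamma_one_sub ((1 - z) / 2)
  rw [show (Real.pi : ℂ) * ((1 - z) / 2) = Real.pi / 2 - Real.pi * z / 2 by ring,
    Complex.sin_pi_div_two_sub, show 1 - (1 - z) / 2 = z / 2 + 1 / 2 by ring, eq_div_iff h] at hrefl
  rw [show 2 * (z / 2) = z by ring] at hdup
  have hsq : (Real.sqrt Real.pi : ℂ) * (Real.sqrt Real.pi : ℂ) = Real.pi := by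
    exact_mod_cast Real.mul_self_sqrt Real.pi_pos.le
  have h2 : (2 : ℂ) ^ (z - 1) * 2 ^ (1 - z) = 1 := by
    rw [← Complex.cpow_add _ _ two_ne_zero]; simp
  have hs : (Real.sqrt Real.pi : ℂ) ≠ 0 := by
    exact_mod_cast (Real.sqrt_pos.2 Real.pi_pos).ne'
  refine mul_left_cancel₀ hs ?_
  have e1 : Complex.Gamma z * (Real.sqrt Real.pi : ℂ) =
      Complex.Gamma (z / 2) * Complex.Gamma (z / 2 + 1 / 2) * 2 ^ (z - 1) := by
    rw [hdup]; linear_combination (-Complex.Gamma z * (Real.sqrt Real.pi : ℂ)) * h2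
  linear_combination (Complex.cos (Real.pi * z / 2) * Complex.Gamma ((1 - z) / 2)) * e1
    + (2 ^ (z - 1) * Complex.Gamma (z / 2)) * hrefl - (2 ^ (z - 1) * Complex.Gamma (z / 2)) * hsq

theorem cos_pi_mul_half_ne_zero {z : ℂ} (h0 : 0 < z.re) (h1 : z.re < 1) :
    Complex.cos (Real.pi * z / 2) ≠ 0 := by
  rw [Ne, Complex.cos_eq_zero_iff]
  rintro ⟨k, hk⟩
  have hpi : (Real.pi : ℂ) ≠ 0 := by exact_mod_cast Real.pi_ne_zero
  have hz : z = ((2 * k + 1 : ℝ) : ℂ) := by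
    push_cast; field_simp at hk; linear_combination hk
  rw [hz, Complex.ofReal_re] at h0 h1
  have a : (-1 : ℤ) < k * 2 := by
    have : (-1 : ℝ) < k * 2 := by linarith
    exact_mod_cast this
  have b : k * 2 < (0 : ℤ) := by
    have : (k : ℝ) * 2 < 0 := by linarith
    exact_mod_cast this
  omega

theorem sin_add_sin_add_sin_pi {p q r : ℂ} (h : p + q + r = 1) :
    Complex.sin (Real.pi * p) + Complex.sin (Real.pi * q) + Complex.sin (Real.pi * r) =
      4 * Complex.cos (Real.pi * p / 2) * Complex.cos (Real.pi * q / 2) *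
        Complex.cos (Real.pi * r / 2) := by
  set P := Real.pi * p / 2 with hP
  set Q := Real.pi * q / 2 with hQ
  have e1 : Real.pi * p = 2 * P := by rw [hP]; ring
  have e2 : Real.pi * q = 2 * Q := by rw [hQ]; ring
  have e3 : Real.pi * r = Real.pi - 2 * (P + Q) := by rw [hP, hQ]; linear_combination Real.pi * h
  have e4 : Real.pi * r / 2 = Real.pi / 2 - (P + Q) := by rw [e3]; ring
  rw [e4, e3, e1, e2, Complex.cos_pi_div_two_sub, Complex.sin_pi_sub, Complex.sin_two_mul,
    Complex.sin_two_mul, Complex.sin_two_mul, Complex.sin_add, Complex.cos_add]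
  have hp := Complex.sin_sq_add_cos_sq P
  have hq := Complex.sin_sq_add_cos_sq Q
  linear_combination (-2 * Complex.sin Q * Complex.cos Q) * hp
    + (-2 * Complex.sin P * Complex.cos P) * hq

theorem betaIntegral_eq_Gamma_mul_sin {p q r : ℂ} (hp : 0 < p.re) (hq : 0 < q.re)
    (hr : 0 < r.re) (h : p + q + r = 1) :
    Complex.betaIntegral p q = Complex.Gamma p * Complex.Gamma q * Complex.Gamma r *
      Complex.sin (Real.pi * r) / Real.pi := by
  have hpi : (Real.pi : ℂ) ≠ 0 := by exact_mod_cast Real.pi_ne_zero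
  have hpq : 0 < (p + q).re := by rw [Complex.add_re]; positivity
  have hB := Complex.Gamma_mul_Gamma_eq_betaIntegral hp hq
  have hR := Complex.Gamma_mul_Gamma_one_sub r
  rw [show 1 - r = p + q by linear_combination -h] at hR
  have hG := Complex.Gamma_ne_zero_of_re_pos hpq
  have hsin : Complex.Gamma r * Complex.Gamma (p + q) * Complex.sin (Real.pi * r) = Real.pi := by
    -- A zero of the sine would turn the right-hand side of the reflection formula into `π / 0 = 0`.
    have hne : (Real.pi : ℂ) / Complex.sin (Real.pi * r) ≠ 0 :=
      hR ▸ mul_ne_zero (Complex.Gamma_ne_zero_of_re_pos hr) hG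
    rw [hR, div_mul_cancel₀ _ (div_ne_zero_iff.1 hne).2]
  rw [eq_div_iff hpi]
  refine mul_left_cancel₀ hG ?_
  linear_combination (-(Real.pi : ℂ)) * hB - (Complex.Gamma p * Complex.Gamma q) * hsin

/-- By `betaIntegral_eq_Gamma_mul_sin` the left-hand side is `Γ(p) Γ(q) Γ(r) / π` times a sum of
three sines. As the angles add up to `π`, the sum is a product of cosines, and each cosine combines
with one Gamma factor by `Gamma_mul_cos_half`. -/
theorem betaIntegral_add_add {p q r : ℂ} (hp : 0 < p.re) (hq : 0 < q.re) (hr : 0 < r.re)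
    (h : p + q + r = 1) :
    Complex.betaIntegral p q + Complex.betaIntegral r q + Complex.betaIntegral r p =
      (Real.sqrt Real.pi : ℂ) *
        (Complex.Gamma (p / 2) * Complex.Gamma (q / 2) * Complex.Gamma (r / 2)) /
        (Complex.Gamma ((1 - p) / 2) * Complex.Gamma ((1 - q) / 2) *
          Complex.Gamma ((1 - r) / 2)) := by
  have hpi : (Real.pi : ℂ) ≠ 0 := by exact_mod_cast Real.pi_ne_zero
  have hre : p.re + q.re + r.re = 1 := by simpa using congrArg Complex.re h
  rw [betaIntegral_eq_Gamma_mul_sin hp hq hr h,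
    betaIntegral_eq_Gamma_mul_sin (r := p) hr hq hp (by linear_combination h),
    betaIntegral_eq_Gamma_mul_sin (r := q) hr hp hq (by linear_combination h)]
  have h1 := Gamma_mul_cos_half p (cos_pi_mul_half_ne_zero hp (by linarith))
  have h2 := Gamma_mul_cos_half q (cos_pi_mul_half_ne_zero hq (by linarith))
  have h3 := Gamma_mul_cos_half r (cos_pi_mul_half_ne_zero hr (by linarith))
  have n : ∀ z : ℂ, z.re < 1 → Complex.Gamma ((1 - z) / 2) ≠ 0 := fun z hz =>
    Complex.Gamma_ne_zero_of_re_pos (by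
      rw [show (1 - z) / 2 = ((1 / 2 : ℝ) : ℂ) * (1 - z) by push_cast; ring, Complex.re_ofReal_mul,
        Complex.sub_re, Complex.one_re]
      linarith)
  have hs := sin_add_sin_add_sin_pi h
  have hsq : (Real.sqrt Real.pi : ℂ) * (Real.sqrt Real.pi : ℂ) = Real.pi := by
    exact_mod_cast Real.mul_self_sqrt Real.pi_pos.le
  have hpow : (2 : ℂ) ^ (p - 1) * 2 ^ (q - 1) * 2 ^ (r - 1) = 1 / 4 := by
    rw [← Complex.cpow_add _ _ two_ne_zero, ← Complex.cpow_add _ _ two_ne_zero,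
      show p - 1 + (q - 1) + (r - 1) = -2 by linear_combination h, Complex.cpow_neg]
    norm_num
  rw [eq_div_iff (mul_ne_zero (mul_ne_zero (n p (by linarith)) (n q (by linarith)))
    (n r (by linarith))), ← add_div, ← add_div, div_mul_eq_mul_div, div_eq_iff hpi]
  generalize Complex.Gamma ((1 - p) / 2) = A at *
  generalize Complex.Gamma ((1 - q) / 2) = B at *
  generalize Complex.Gamma ((1 - r) / 2) = C at *
  set S := (Real.sqrt Real.pi : ℂ)
  have h123 := congrArg₂ (· * ·) (congrArg₂ (· * ·) h1 h2) h3
  linear_combination (Complex.Gamma p * Complex.Gamma q * Complex.Gamma r * A * B * C) * hs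
    + 4 * h123
    + (4 * S ^ 3 * Complex.Gamma (p / 2) * Complex.Gamma (q / 2) * Complex.Gamma (r / 2)) * hpow
    + (S * Complex.Gamma (p / 2) * Complex.Gamma (q / 2) * Complex.Gamma (r / 2)) * hsq

/-! ### The Mellin-Barnes integral of a convolution -/

theorem integrable_Gamma_kernel {α s : ℝ} (hα : 0 < α) (hs : -(1 / 2) < s) :
    Integrable fun u : ℝ => Complex.Gamma ((1 + 2 * (s + u * Complex.I)) / α) := by
  have hα' : (α : ℂ) ≠ 0 := by exact_mod_cast hα.ne'
  have hc : 0 < (1 + 2 * s) / α := div_pos (by linarith) hα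
  refine ((integrable_Gamma_vertical hc).comp_mul_left' (R := 2 / α) (by positivity)).congr
    (Filter.Eventually.of_forall fun u => ?_)
  simp only
  congr 1
  push_cast
  field_simp
  ring

/-- The integrand `Γ((1 + 2ξ)/α) (a|x|)^(-1-2ξ)`, with `ξ = s + iu`, of the Mellin-Barnes integral
for `exp (-(a|x|)^α)`. -/
noncomputable def mellinKernel (α a s u x : ℝ) : ℂ :=
  Complex.Gamma ((1 + 2 * (s + u * Complex.I)) / α) *
    ((a * |x| : ℝ) : ℂ) ^ (-(1 + 2 * (s + u * Complex.I)))

/-- The norm splits into a function of `u` and a function of `x`. At `x = 0` the identity rests on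
`0 ^ w = 0` for `w ≠ 0`, and the exponent is nonzero since `s > -1/2`. -/
theorem norm_mellinKernel {α a s : ℝ} (ha : 0 < a) (hs : -(1 / 2) < s) (u x : ℝ) :
    ‖mellinKernel α a s u x‖ = ‖Complex.Gamma ((1 + 2 * (s + u * Complex.I)) / α)‖ *
      (a ^ (-2 * s - 1) * ‖((|x| : ℝ) : ℂ) ^ (((-2 * s : ℝ) : ℂ) - 1)‖) := by
  have h1 : (-(1 + 2 * (s + u * Complex.I)) : ℂ).re = -2 * s - 1 := by simp; ring
  have h2 : (((-2 * s : ℝ) : ℂ) - 1).re = -2 * s - 1 := by simp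
  have h0 : -2 * s - 1 ≠ 0 := by linarith
  rw [mellinKernel, norm_mul, Complex.norm_cpow_eq_rpow_re_of_nonneg (by positivity) (by rwa [h1]),
    Complex.norm_cpow_eq_rpow_re_of_nonneg (by positivity) (by rwa [h2]), h1, h2,
    Real.mul_rpow ha.le (abs_nonneg x)]

theorem integrable_mellinKernel_mul {α β a b s t z : ℝ} (hα : 0 < α) (hβ : 0 < β) (ha : 0 < a)
    (hb : 0 < b) (hs : s < 0) (ht : t < 0) (hst : -(1 / 2) < s + t) (hz : z ≠ 0) :
    Integrable fun w : (ℝ × ℝ) × ℝ =>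
      mellinKernel α a s w.1.1 w.2 * mellinKernel β b t w.1.2 (z - w.2) := by
  have hA := integrable_Gamma_kernel hα (by linarith : -(1 / 2) < s)
  have hB := integrable_Gamma_kernel hβ (by linarith : -(1 / 2) < t)
  have hK := (integral_abs_cpow_mul_abs_sub_cpow (p := ((-2 * s : ℝ) : ℂ)) (q := ((-2 * t : ℝ) : ℂ))
    (by rw [Complex.ofReal_re]; linarith) (by rw [Complex.ofReal_re]; linarith)
    (by rw [Complex.add_re, Complex.ofReal_re, Complex.ofReal_re]; linarith) hz).1
  have hprod := ((hA.mul_prod hB).mul_prod hK).const_mul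
    ((a ^ (-2 * s - 1) * b ^ (-2 * t - 1) : ℝ) : ℂ)
  refine hprod.mono ?_ (Filter.Eventually.of_forall fun w => le_of_eq ?_)
  · refine AEStronglyMeasurable.mul ?_ ?_
    · refine AEStronglyMeasurable.mul ?_
        (Measurable.pow (by fun_prop) (by fun_prop)).aestronglyMeasurable
      exact hA.aestronglyMeasurable.comp_fst.comp_fst
    · refine AEStronglyMeasurable.mul ?_
        (Measurable.pow (by fun_prop) (by fun_prop)).aestronglyMeasurable
      exact hB.aestronglyMeasurable.comp_snd.comp_fst
  · rw [norm_mul, norm_mellinKernel ha (by linarith), norm_mellinKernel hb (by linarith)]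
    simp only [norm_mul, Complex.norm_real]
    rw [Real.norm_of_nonneg (by positivity), Real.norm_of_nonneg (by positivity)]
    ring

theorem exp_neg_rpow_eq_integral_mellinKernel {α a s x : ℝ} (hα : 0 < α) (ha : 0 < a)
    (hs : -(1 / 2) < s) (hx : x ≠ 0) :
    (Real.exp (-(a * |x|) ^ α) : ℂ) = 1 / (Real.pi * α) * ∫ u : ℝ, mellinKernel α a s u x :=
  exp_neg_rpow_eq_integral_Gamma hα hs (mul_pos ha (abs_pos.2 hx))

theorem sumGGDData_separates_iff {α β : ℝ} (hα : 0 < α) (hβ : 0 < β) (s t : ℝ) :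
    (sumGGDData α β hα hβ).Separates s t ↔ s < 0 ∧ t < 0 ∧ -(1 / 2) < s + t := by
  have h1 : (1 / (α : ℂ)).re = 1 / α := by rw [← Complex.ofReal_one, ← Complex.ofReal_div]; rfl
  have h2 : (1 / (β : ℂ)).re = 1 / β := by rw [← Complex.ofReal_one, ← Complex.ofReal_div]; rfl
  have h3 : ∀ {γ r : ℝ}, 0 < γ → (0 < 1 - (1 - 1 / γ) + 2 / γ * r ↔ -(1 / 2) < r) :=
    fun {γ r} hγ => by
    rw [show 1 - (1 - 1 / γ) + 2 / γ * r = (1 + 2 * r) / γ by ring, div_pos_iff_of_pos_right hγ]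
    constructor <;> intro <;> linarith
  have hhalf : (1 / 2 : ℂ).re = 1 / 2 := by norm_num
  simp only [BivFoxHData.Separates, sumGGDData, List.take_succ_cons, List.take_zero,
    List.mem_singleton, forall_eq, Complex.sub_re, Complex.one_re, h1, h2, h3 hα, h3 hβ, hhalf,
    Complex.zero_re]
  constructor
  · rintro ⟨h, -, hs, -, ht⟩
    exact ⟨by linarith, by linarith, by linarith⟩
  · rintro ⟨hs, ht, h⟩
    exact ⟨by linarith, by linarith, by linarith, by linarith, by linarith⟩

theorem sumGGDData_integrand {α β : ℝ} (hα : 0 < α) (hβ : 0 < β) (x y ξ η : ℂ) :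
    (sumGGDData α β hα hβ).integrand x y ξ η =
      Complex.Gamma (1 / 2 + ξ + η) / Complex.Gamma (-ξ - η) *
      (Complex.Gamma (-ξ) * Complex.Gamma ((1 + 2 * ξ) / α) / Complex.Gamma (1 / 2 + ξ)) *
      (Complex.Gamma (-η) * Complex.Gamma ((1 + 2 * η) / β) / Complex.Gamma (1 / 2 + η)) *
      x ^ ξ * y ^ η := by
  have h : ∀ (γ : ℝ) (ζ : ℂ), 1 - (1 - 1 / (γ : ℂ)) + ((2 / γ : ℝ) : ℂ) * ζ = (1 + 2 * ζ) / γ :=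
    fun γ ζ => by push_cast; ring
  simp only [BivFoxHData.integrand, BivFoxHData.kernelOne, BivFoxHData.kernelTwo, sumGGDData,
    List.take_succ_cons, List.take_zero, List.drop_succ_cons, List.drop_zero, List.map_cons,
    List.map_nil, List.prod_cons, List.prod_nil, mul_one, h, Complex.ofReal_one, one_mul, zero_sub]
  rw [show (1 - 1 / 2 : ℂ) = 1 / 2 by norm_num]

/-- Integrating the product of the two kernels over `x` produces the Mellin-Barnes integrand: the
Riesz composition formula with `p = -2ξ`, `q = -2η` supplies all Gamma factors but
`Γ((1 + 2ξ)/α)` and `Γ((1 + 2η)/β)`. -/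
theorem integral_mellinKernel_mul {α β a b s t z : ℝ} (hα : 0 < α) (hβ : 0 < β) (ha : 0 < a)
    (hb : 0 < b) (hs : s < 0) (ht : t < 0) (hst : -(1 / 2) < s + t) (hz : z ≠ 0) (w : ℝ × ℝ) :
    ∫ x : ℝ, mellinKernel α a s w.1 x * mellinKernel β b t w.2 (z - x) =
      Real.sqrt Real.pi / (a * b * |z| : ℝ) * (sumGGDData α β hα hβ).onLines
        (((a * |z|) ^ 2)⁻¹ : ℝ) (((b * |z|) ^ 2)⁻¹ : ℝ) s t w := by
  obtain ⟨u, v⟩ := w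
  rw [BivFoxHData.onLines, sumGGDData_integrand]
  simp only [mellinKernel]
  set ξ : ℂ := s + u * Complex.I with hξ
  set η : ℂ := t + v * Complex.I with hη
  have hξre : ξ.re = s := by simp [hξ]
  have hηre : η.re = t := by simp [hη]
  have hz0 : 0 < |z| := abs_pos.2 hz
  have hpre : (-2 * ξ).re = -2 * s := by simp [hξre]
  have hqre : (-2 * η).re = -2 * t := by simp [hηre]
  have hK := (integral_abs_cpow_mul_abs_sub_cpow (p := -2 * ξ) (q := -2 * η)
    (by rw [hpre]; linarith)
    (by rw [hqre]; linarith) (by rw [Complex.add_re, hpre, hqre]; linarith) hz).2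
  have hr : 0 < (1 - -2 * ξ - -2 * η).re := by
    rw [Complex.sub_re, Complex.sub_re, hpre, hqre, Complex.one_re]; linarith
  rw [betaIntegral_add_add (by rw [hpre]; linarith) (by rw [hqre]; linarith) hr (by ring)] at hK
  have hint : ∀ x : ℝ, Complex.Gamma ((1 + 2 * ξ) / α) * ((a * |x| : ℝ) : ℂ) ^ (-(1 + 2 * ξ)) *
      (Complex.Gamma ((1 + 2 * η) / β) * ((b * |z - x| : ℝ) : ℂ) ^ (-(1 + 2 * η))) =
      Complex.Gamma ((1 + 2 * ξ) / α) * Complex.Gamma ((1 + 2 * η) / β) *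
        ((a : ℂ) ^ (-2 * ξ - 1) * (b : ℂ) ^ (-2 * η - 1)) *
        (((|x| : ℝ) : ℂ) ^ (-2 * ξ - 1) * ((|z - x| : ℝ) : ℂ) ^ (-2 * η - 1)) := fun x => by
    rw [show -(1 + 2 * ξ) = -2 * ξ - 1 by ring, show -(1 + 2 * η) = -2 * η - 1 by ring,
      Complex.ofReal_mul, Complex.ofReal_mul, Complex.mul_cpow_ofReal_nonneg ha.le (abs_nonneg _),
      Complex.mul_cpow_ofReal_nonneg hb.le (abs_nonneg _)]
    ring
  simp only [hint]
  rw [integral_const_mul, hK]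
  have hpow : ∀ {c : ℝ} (ζ : ℂ), 0 < c → (((((c * |z|) ^ 2)⁻¹ : ℝ)) : ℂ) ^ ζ =
      (c : ℂ) ^ (-2 * ζ) * ((|z| : ℝ) : ℂ) ^ (-2 * ζ) := fun {c} ζ hc => by
    have h : ((c * |z|) ^ 2)⁻¹ = (c * |z|) ^ (-2 : ℝ) := by
      rw [Real.rpow_neg (by positivity)]; norm_num
    rw [h, ← Complex.cpow_mul_ofReal_nonneg (by positivity), Complex.ofReal_mul,
      Complex.mul_cpow_ofReal_nonneg hc.le hz0.le]
    norm_num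
  have ha' : (a : ℂ) ≠ 0 := by exact_mod_cast ha.ne'
  have hb' : (b : ℂ) ≠ 0 := by exact_mod_cast hb.ne'
  have hz' : ((|z| : ℝ) : ℂ) ≠ 0 := by exact_mod_cast hz0.ne'
  rw [hpow ξ ha, hpow η hb, Complex.cpow_sub _ _ ha', Complex.cpow_sub _ _ hb',
    Complex.cpow_sub _ _ hz', Complex.cpow_add _ _ hz', Complex.cpow_one, Complex.cpow_one,
    Complex.cpow_one, show -2 * ξ / 2 = -ξ by ring, show -2 * η / 2 = -η by ring,
    show (1 - -2 * ξ - -2 * η) / 2 = 1 / 2 + ξ + η by ring,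
    show (1 - -2 * ξ) / 2 = 1 / 2 + ξ by ring, show (1 - -2 * η) / 2 = 1 / 2 + η by ring,
    show (1 - (1 - -2 * ξ - -2 * η)) / 2 = -ξ - η by ring]
  push_cast
  simp only [div_eq_mul_inv, mul_inv]
  ring

/-- Fubini's theorem for the product of the two kernels, integrated over `(u, v)` and `x` in either
order. -/
theorem exp_conv_eq_integral_onLines {α β a b s t z : ℝ} (hα : 0 < α) (hβ : 0 < β) (ha : 0 < a)
    (hb : 0 < b) (hs : s < 0) (ht : t < 0) (hst : -(1 / 2) < s + t) (hz : z ≠ 0) :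
    Integrable ((sumGGDData α β hα hβ).onLines
        (((a * |z|) ^ 2)⁻¹ : ℝ) (((b * |z|) ^ 2)⁻¹ : ℝ) s t) ∧
    ((∫ x : ℝ, Real.exp (-(a * |x|) ^ α) * Real.exp (-(b * |z - x|) ^ β) : ℝ) : ℂ) =
      1 / (Real.pi * α) * (1 / (Real.pi * β)) * (Real.sqrt Real.pi / (a * b * |z| : ℝ)) *
      ∫ w, (sumGGDData α β hα hβ).onLines
        (((a * |z|) ^ 2)⁻¹ : ℝ) (((b * |z|) ^ 2)⁻¹ : ℝ) s t w := by
  have hI := integrable_mellinKernel_mul hα hβ ha hb hs ht hst hz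
  have hfun := funext (integral_mellinKernel_mul hα hβ ha hb hs ht hst hz)
  have hne : (Real.sqrt Real.pi / (a * b * |z| : ℝ) : ℂ) ≠ 0 := by
    have h1 : Real.sqrt Real.pi ≠ 0 := (Real.sqrt_pos.2 Real.pi_pos).ne'
    have h2 : a * b * |z| ≠ 0 := (mul_pos (mul_pos ha hb) (abs_pos.2 hz)).ne'
    exact div_ne_zero (by exact_mod_cast h1) (by exact_mod_cast h2)
  constructor
  · have h := hI.integral_prod_left
    simp only [hfun] at h
    exact (integrable_const_mul_iff (isUnit_iff_ne_zero.2 hne) _).1 h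
  · rw [mul_assoc, ← integral_const_mul]
    simp only [← integral_mellinKernel_mul hα hβ ha hb hs ht hst hz]
    rw [integral_integral_swap hI, ← integral_complex_ofReal, ← integral_const_mul]
    refine integral_congr_ae ?_
    filter_upwards [Measure.ae_ne volume 0, Measure.ae_ne volume z] with x hx hxz
    rw [Measure.volume_eq_prod, integral_prod_mul (fun u => mellinKernel α a s u x)
        (fun v => mellinKernel β b t v (z - x)),
      Complex.ofReal_mul, exp_neg_rpow_eq_integral_mellinKernel (s := s) hα ha (by linarith) hx,
      exp_neg_rpow_eq_integral_mellinKernel (s := t) hβ hb (by linarith)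
        (sub_ne_zero.2 hxz.symm)]
    ring

/-! ### The generalized Gaussian density -/

theorem ggdScale_pos {σ α : ℝ} (hσ : 0 < σ) (hα : 0 < α) : 0 < ggdScale σ α :=
  mul_pos (one_div_pos.2 hσ) (Real.sqrt_pos.2
    (div_pos (Real.Gamma_pos_of_pos (by positivity)) (Real.Gamma_pos_of_pos (by positivity))))

theorem inv_sq_ggdScale_mul {σ α : ℝ} (hα : 0 < α) (z : ℝ) :
    ((ggdScale σ α * |z|) ^ 2)⁻¹ = σ ^ 2 * Real.Gamma (1 / α) / (Real.Gamma (3 / α) * z ^ 2) := by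
  have h1 : 0 < Real.Gamma (1 / α) := Real.Gamma_pos_of_pos (by positivity)
  have h3 : 0 < Real.Gamma (3 / α) := Real.Gamma_pos_of_pos (by positivity)
  rw [ggdScale, mul_pow, mul_pow, Real.sq_sqrt (by positivity), sq_abs, mul_inv, mul_inv, div_pow,
    inv_div, inv_div]
  field_simp

theorem ggdPDF_eq {σ α : ℝ} (hσ : 0 < σ) (hα : 0 < α) (μ x : ℝ) :
    ggdPDF μ σ α x = α * ggdScale σ α / (2 * Real.Gamma (1 / α)) *
      Real.exp (-(ggdScale σ α * |x - μ|) ^ α) := by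
  rw [ggdPDF, Real.mul_rpow (ggdScale_pos hσ hα).le (abs_nonneg _)]

theorem ggdPDF_nonneg {σ α : ℝ} (hσ : 0 < σ) (hα : 0 < α) (μ x : ℝ) : 0 ≤ ggdPDF μ σ α x := by
  have := ggdScale_pos hσ hα
  have := Real.Gamma_pos_of_pos (one_div_pos.2 hα)
  rw [ggdPDF]
  positivity

theorem continuous_ggdPDF {α : ℝ} (hα : 0 < α) (μ σ : ℝ) : Continuous (ggdPDF μ σ α) := by
  unfold ggdPDF
  refine continuous_const.mul (Real.continuous_exp.comp (Continuous.neg (continuous_const.mul ?_)))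
  exact Continuous.rpow_const (by fun_prop) fun _ => Or.inr hα.le

theorem ggdPDF_le {σ α : ℝ} (hσ : 0 < σ) (hα : 0 < α) (μ x : ℝ) :
    ggdPDF μ σ α x ≤ α * ggdScale σ α / (2 * Real.Gamma (1 / α)) := by
  have h := ggdScale_pos hσ hα
  have := Real.Gamma_pos_of_pos (one_div_pos.2 hα)
  rw [ggdPDF]
  refine mul_le_of_le_one_right (by positivity) (Real.exp_le_one_iff.2 ?_)
  have : 0 ≤ ggdScale σ α ^ α * |x - μ| ^ α := by positivity
  linarith

theorem integrable_comp_abs_of_integrableOn_Ioi {f : ℝ → ℝ} (hf : IntegrableOn f (Set.Ioi 0)) :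
    Integrable fun x => f |x| := by
  have hpos : IntegrableOn (fun x => f |x|) (Set.Ioi 0) :=
    hf.congr_fun (fun x hx => by rw [abs_of_pos hx]) measurableSet_Ioi
  have hneg : IntegrableOn (fun x => f |x|) (Set.Iio 0) := by
    have h := ((Measure.measurePreserving_neg (volume : Measure ℝ)).integrableOn_comp_preimage
      (Homeomorph.neg ℝ).measurableEmbedding).2 hpos
    simpa [Function.comp_def] using h
  rw [← integrableOn_univ, ← Set.Iic_union_Ioi (a := (0 : ℝ))]
  exact ((integrableOn_Iic_iff_integrableOn_Iio).2 hneg).union hpos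

theorem integrable_ggdPDF {σ α : ℝ} (hσ : 0 < σ) (hα : 0 < α) (μ : ℝ) :
    Integrable (ggdPDF μ σ α) := by
  have h := integrableOn_rpow_mul_exp_neg_mul_rpow (p := α) (s := 0) (b := ggdScale σ α ^ α)
    (by norm_num) hα (Real.rpow_pos_of_pos (ggdScale_pos hσ hα) α)
  have h' : Integrable fun x : ℝ => Real.exp (-(ggdScale σ α ^ α * |x| ^ α)) :=
    integrable_comp_abs_of_integrableOn_Ioi
      (f := fun x => Real.exp (-(ggdScale σ α ^ α * x ^ α))) (by simpa using h)
  exact (h'.comp_sub_right μ).const_mul _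

/-! ### Sums of independent random variables with densities -/

theorem hasLaw_add_withDensity {Ω : Type*} [MeasurableSpace Ω] {P : Measure Ω} {X Y : Ω → ℝ}
    {f g : ℝ → ℝ} (hf : Integrable f) (hf0 : 0 ≤ f) (hg : Measurable g) (hg0 : 0 ≤ g)
    {C : ℝ} (hC : ∀ x, g x ≤ C) (hfm : Measurable f)
    (hX : HasLaw X (volume.withDensity fun x => ENNReal.ofReal (f x)) P)
    (hY : HasLaw Y (volume.withDensity fun x => ENNReal.ofReal (g x)) P) (hXY : IndepFun X Y P) :
    HasLaw (X + Y) (volume.withDensity fun z => ENNReal.ofReal (∫ x, f x * g (z - x))) P := by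
  have h := hXY.hasLaw_add hX hY
  rw [conv_withDensity_eq_lconvolution hfm.ennreal_ofReal hg.ennreal_ofReal] at h
  refine (congrArg (HasLaw (X + Y) · P) (congrArg volume.withDensity (funext fun z => ?_))).mpr h
  rw [lconvolution_def, ofReal_integral_eq_lintegral_ofReal]
  · refine lintegral_congr fun x => ?_
    rw [ENNReal.ofReal_mul (hf0 x), neg_add_eq_sub]
  · refine hf.mul_bdd (c := C) (hg.comp (measurable_const.sub measurable_id)).aestronglyMeasurable
      (Filter.Eventually.of_forall fun x => ?_)
    rw [Real.norm_of_nonneg (hg0 _)]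
    exact hC (z - x)
  · exact Filter.Eventually.of_forall fun x => mul_nonneg (hf0 x) (hg0 _)

theorem continuous_integral_mul_comp_sub {f g : ℝ → ℝ} (hf : Integrable f) (hg : Continuous g)
    {C : ℝ} (hC : ∀ x, |g x| ≤ C) : Continuous fun z => ∫ x, f x * g (z - x) :=
  BddAbove.continuous_convolution_right_of_integrable (ContinuousLinearMap.mul ℝ ℝ)
    ⟨C, by rintro _ ⟨x, rfl⟩; exact hC x⟩ hf hg

/-! ### The density of the sum -/

theorem integral_ggdPDF_mul {σ₁ σ₂ α β : ℝ} (hσ₁ : 0 < σ₁) (hσ₂ : 0 < σ₂) (hα : 0 < α)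
    (hβ : 0 < β) (μ₁ μ₂ z : ℝ) :
    ∫ x, ggdPDF μ₁ σ₁ α x * ggdPDF μ₂ σ₂ β (z - x) =
      α * ggdScale σ₁ α / (2 * Real.Gamma (1 / α)) * (β * ggdScale σ₂ β / (2 * Real.Gamma (1 / β))) *
      ∫ x, Real.exp (-(ggdScale σ₁ α * |x|) ^ α) *
        Real.exp (-(ggdScale σ₂ β * |z - (μ₁ + μ₂) - x|) ^ β) := by
  rw [← integral_const_mul, ← integral_add_right_eq_self _ μ₁]
  refine integral_congr_ae (Filter.Eventually.of_forall fun x => ?_)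
  simp only [ggdPDF_eq hσ₁ hα, ggdPDF_eq hσ₂ hβ]
  rw [show x + μ₁ - μ₁ = x by ring, show z - (x + μ₁) - μ₂ = z - (μ₁ + μ₂) - x by ring]
  ring

/-- Every pair of separating lines gives the same value because each of them computes the
convolution of the two densities. -/
theorem sumGGDData_hasValue {σ₁ σ₂ α β : ℝ} (hσ₁ : 0 < σ₁) (hσ₂ : 0 < σ₂) (hα : 0 < α)
    (hβ : 0 < β) (μ₁ μ₂ : ℝ) {z : ℝ} (hz : z ≠ μ₁ + μ₂) :
    (sumGGDData α β hα hβ).HasValue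
      (σ₁ ^ 2 * Real.Gamma (1 / α) / (Real.Gamma (3 / α) * (z - (μ₁ + μ₂)) ^ 2) : ℝ)
      (σ₂ ^ 2 * Real.Gamma (1 / β) / (Real.Gamma (3 / β) * (z - (μ₁ + μ₂)) ^ 2) : ℝ)
      ((Real.Gamma (1 / α) * Real.Gamma (1 / β) * |z - (μ₁ + μ₂)| / Real.sqrt Real.pi *
        ∫ x, ggdPDF μ₁ σ₁ α x * ggdPDF μ₂ σ₂ β (z - x) : ℝ) : ℂ) := by
  refine ⟨⟨-(1 / 8), -(1 / 8), (sumGGDData_separates_iff hα hβ _ _).2 (by norm_num)⟩,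
    fun s t hst => ?_⟩
  obtain ⟨hs, ht, hst⟩ := (sumGGDData_separates_iff hα hβ s t).1 hst
  have ha := ggdScale_pos hσ₁ hα
  have hb := ggdScale_pos hσ₂ hβ
  have hz0 : 0 < |z - (μ₁ + μ₂)| := abs_pos.2 (sub_ne_zero.2 hz)
  have h := exp_conv_eq_integral_onLines hα hβ ha hb hs ht hst (sub_ne_zero.2 hz)
  rw [← inv_sq_ggdScale_mul hα, ← inv_sq_ggdScale_mul hβ]
  refine ⟨h.1, ?_⟩
  rw [integral_ggdPDF_mul hσ₁ hσ₂ hα hβ, ← mul_assoc, Complex.ofReal_mul, h.2, ← mul_assoc]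
  congr 1
  norm_cast
  have hΓ₁ := Real.Gamma_pos_of_pos (one_div_pos.2 hα)
  have hΓ₂ := Real.Gamma_pos_of_pos (one_div_pos.2 hβ)
  have hpi := Real.pi_pos
  have hsq := Real.sqrt_pos.2 hpi
  field_simp

theorem theorem3 {Ω : Type*} [MeasurableSpace Ω] (P : Measure Ω) [IsProbabilityMeasure P]
    (X Y : Ω → ℝ) (μ₁ μ₂ σ₁ σ₂ α β : ℝ)
    (hσ₁ : 0 < σ₁) (hσ₂ : 0 < σ₂) (hα : 0 < α) (hβ : 0 < β)
    (hX : HasLaw X (ggd μ₁ σ₁ α) P) (hY : HasLaw Y (ggd μ₂ σ₂ β) P)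
    (hXY : IndepFun X Y P) :
    ∃ fZ : ℝ → ℝ, Continuous fZ ∧ (∀ z, 0 ≤ fZ z) ∧
      HasLaw (X + Y) (volume.withDensity fun z => ENNReal.ofReal (fZ z)) P ∧
      ∀ z : ℝ, z ≠ μ₁ + μ₂ →
        (sumGGDData α β hα hβ).Converges
          (σ₁ ^ 2 * Real.Gamma (1 / α) / (Real.Gamma (3 / α) * (z - (μ₁ + μ₂)) ^ 2) : ℝ)
          (σ₂ ^ 2 * Real.Gamma (1 / β) / (Real.Gamma (3 / β) * (z - (μ₁ + μ₂)) ^ 2) : ℝ) ∧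
        (fZ z : ℂ) =
          (Real.sqrt Real.pi /
              (Real.Gamma (1 / α) * Real.Gamma (1 / β) * |z - (μ₁ + μ₂)|) : ℝ) *
            (sumGGDData α β hα hβ).H
              (σ₁ ^ 2 * Real.Gamma (1 / α) / (Real.Gamma (3 / α) * (z - (μ₁ + μ₂)) ^ 2) : ℝ)
              (σ₂ ^ 2 * Real.Gamma (1 / β) / (Real.Gamma (3 / β) * (z - (μ₁ + μ₂)) ^ 2) : ℝ) := by
  have hbdd := ggdPDF_le hσ₂ hβ μ₂
  refine ⟨fun z => ∫ x, ggdPDF μ₁ σ₁ α x * ggdPDF μ₂ σ₂ β (z - x), ?_, fun z => ?_, ?_,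
    fun z hz => ?_⟩
  · refine continuous_integral_mul_comp_sub (integrable_ggdPDF hσ₁ hα μ₁)
      (continuous_ggdPDF hβ μ₂ σ₂)
      (C := β * ggdScale σ₂ β / (2 * Real.Gamma (1 / β))) fun x => ?_
    rw [abs_of_nonneg (ggdPDF_nonneg hσ₂ hβ μ₂ x)]
    exact hbdd x
  · exact integral_nonneg fun x =>
      mul_nonneg (ggdPDF_nonneg hσ₁ hα μ₁ x) (ggdPDF_nonneg hσ₂ hβ μ₂ _)
  · exact hasLaw_add_withDensity (integrable_ggdPDF hσ₁ hα μ₁) (ggdPDF_nonneg hσ₁ hα μ₁)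
      (continuous_ggdPDF hβ μ₂ σ₂).measurable (ggdPDF_nonneg hσ₂ hβ μ₂) hbdd
      (continuous_ggdPDF hα μ₁ σ₁).measurable hX hY hXY
  · have hval := sumGGDData_hasValue hσ₁ hσ₂ hα hβ μ₁ μ₂ hz
    refine ⟨⟨_, hval⟩, ?_⟩
    rw [hval.H_eq, ← Complex.ofReal_mul, ← mul_assoc]
    congr 1
    have hΓ₁ := Real.Gamma_pos_of_pos (one_div_pos.2 hα)
    have hΓ₂ := Real.Gamma_pos_of_pos (one_div_pos.2 hβ)
    have hsq := Real.sqrt_pos.2 Real.pi_pos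
    have hz0 : 0 < |z - (μ₁ + μ₂)| := abs_pos.2 (sub_ne_zero.2 hz)
    field_simp
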